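/- Theorem (Complete DAGs). Let $n\ge 1$. The complete bitnet $\tilde K_n$ is the family of probability distributions on $\{0,1\}^n$ $$P_\theta(x)=\prod_{k=1}^n \theta_{k,s_k}^{x_k}(1-\theta_{k,s_k})^{1-x_k},\qquad s_k=(x_1,\dots,x_{k-1}),$$ that is, the Bayesian network of $n$ binary nodes with all edges $j\to k$ for $j<k$, with parameters $\theta_{k,s}=P(X_k=1\mid (X_1,\dots,X_{k-1})=s)\in(0,1)$ for $1\le k\le n$, $s\in\{0,1\}^{k-1}$. For a smooth parametric family $p_\theta$ on a finite set $\Omega$, parametrized by an open set $U\subset\mathbb R^d$, the Fisher matrix is $g_{ij}(\theta)=\sum_{x\in\Omega} p_\theta(x)\,\partial_i\log p_\theta(x)\,\partial_j\log p_\theta(x)$, and the Fisher volume is $\int_U\sqrt{\det g(\theta)}\,d\theta$; the Ricci scalar is that of the Levi-Civita connection of $g$. Then: 1. $\tilde K_n$ has $d=2^n-1$ parameters, and it agrees, up to a diffeomorphic change of parameters, with the multinomial model of all strictly positive probability distributions on the $2^n$ outcomes $\{0,1\}^n$ (parametrized by the probabilities $p_x$, $x\ne o$, for any fixed reference outcome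 $o$). 2. In both parametrizations $g$ is a smooth Riemannian metric, and the map $\theta\mapsto(2\sqrt{p_\theta(x)})_{x\in\{0,1\}^n}$ is a Riemannian isometry onto the open positive orthant of the sphere of radius $2$ about the origin in $\mathbb R^{2^n}$, with the metric induced from the Euclidean one. 3. In both parametrizations the Fisher volume is $$\mathrm{Vol}(\tilde K_n)=\frac{\pi^{2^{n-1}}}{(2^{n-1}-1)!}.$$ 4. In both parametrizations the Ricci scalar is constant: $$R=\frac{d(d-1)}{4}=\frac{(2^n-1)(2^n-2)}{4}.$$ -/

import Mathlib

open MeasureTheory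
open scoped ContDiff

noncomputable section

/-! ## Coordinate Riemannian geometry on an open subset of `ℝ^ι` -/

section Riemannian

variable {ι : Type*} [Fintype ι] [DecidableEq ι]

/-- The partial derivative `∂_a f` at `θ`. -/
def partialDeriv (a : ι) (f : (ι → ℝ) → ℝ) (θ : ι → ℝ) : ℝ :=
  fderiv ℝ f θ (Pi.single a 1)

/-- The matrix field `g` is a smooth Riemannian metric on `U`. -/
def IsRiemannianMetricOn (g : (ι → ℝ) → Matrix ι ι ℝ) (U : Set (ι → ℝ)) : Prop :=
  (∀ i j, ContDiffOn ℝ ∞ (fun θ => g θ i j) U) ∧ ∀ θ ∈ U, (g θ).PosDef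

/-- Christoffel symbols of the Levi-Civita connection:
`Γ^k_{ij} = ½ ∑_l g^{kl} (∂_i g_{jl} + ∂_j g_{il} - ∂_l g_{ij})`. -/
def christoffel (g : (ι → ℝ) → Matrix ι ι ℝ) (k i j : ι) (θ : ι → ℝ) : ℝ :=
  (1 / 2) * ∑ l, (g θ)⁻¹ k l *
    (partialDeriv i (fun η => g η j l) θ + partialDeriv j (fun η => g η i l) θ
      - partialDeriv l (fun η => g η i j) θ)

/-- Riemann curvature tensor `R^l_{kij}`, where
`R(∂_i, ∂_j) ∂_k = ∑_l R^l_{kij} ∂_l` and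
`R(X, Y) = ∇_X ∇_Y - ∇_Y ∇_X - ∇_{[X, Y]}`. -/
def riemannTensor (g : (ι → ℝ) → Matrix ι ι ℝ) (l k i j : ι) (θ : ι → ℝ) : ℝ :=
  partialDeriv i (christoffel g l j k) θ - partialDeriv j (christoffel g l i k) θ
    + ∑ m, (christoffel g l i m θ * christoffel g m j k θ
      - christoffel g l j m θ * christoffel g m i k θ)

/-- Ricci tensor `Ric_{kj} = ∑_i R^i_{kij}`. -/
def ricciTensor (g : (ι → ℝ) → Matrix ι ι ℝ) (k j : ι) (θ : ι → ℝ) : ℝ :=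
  ∑ i, riemannTensor g i k i j θ

/-- Ricci scalar `R = ∑_{k,j} g^{kj} Ric_{kj}`. -/
def ricciScalar (g : (ι → ℝ) → Matrix ι ι ℝ) (θ : ι → ℝ) : ℝ :=
  ∑ k, ∑ j, (g θ)⁻¹ k j * ricciTensor g k j θ

/-- Riemannian volume `∫_U √(det g) dθ`, as an extended nonnegative number. -/
def riemannianVolume (g : (ι → ℝ) → Matrix ι ι ℝ) (U : Set (ι → ℝ)) : ENNReal :=
  ∫⁻ θ in U, ENNReal.ofReal (Real.sqrt (g θ).det)

/-- `F` is an isometry of the Riemannian manifold `(U, g)` onto the submanifold `S` of the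
Euclidean space `E` with its induced metric: a smooth bijection `U → S` whose inverse is smooth
(it extends smoothly to a neighbourhood of `S`) and which pulls the Euclidean inner product
back to `g`. -/
structure IsIsometryOnto {E : Type*} [NormedAddCommGroup E] [InnerProductSpace ℝ E]
    (g : (ι → ℝ) → Matrix ι ι ℝ) (U : Set (ι → ℝ)) (F : (ι → ℝ) → E) (S : Set E) : Prop where
  smooth : ContDiffOn ℝ ∞ F U
  bijOn : Set.BijOn F U S
  smooth_inverse : ∃ (V : Set E) (G : E → ι → ℝ), IsOpen V ∧ S ⊆ V ∧ ContDiffOn ℝ ∞ G V ∧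
    ∀ θ ∈ U, G (F θ) = θ
  pullback : ∀ θ ∈ U, ∀ u v : ι → ℝ,
    inner ℝ (fderiv ℝ F θ u) (fderiv ℝ F θ v) = ∑ i, ∑ j, u i * g θ i j * v j

end Riemannian

/-- The open positive orthant of the sphere of radius `r` centred at the origin of `ℝ^Ω`
(a sphere of dimension `|Ω| - 1`). -/
def positiveSphereOrthant (Ω : Type*) [Fintype Ω] (r : ℝ) : Set (EuclideanSpace ℝ Ω) :=
  {y | y ∈ Metric.sphere (0 : EuclideanSpace ℝ Ω) r ∧ ∀ x, 0 < y x}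

/-! ## Parametric models on a finite sample space and their Fisher geometry -/

/-- A parametric family of probability mass functions on `Ω`, with coordinates indexed
by `ι`. -/
structure StatModel (ι Ω : Type*) where
  /-- the parameter domain -/
  domain : Set (ι → ℝ)
  /-- `prob θ x` is the probability of the outcome `x` under the parameter `θ` -/
  prob : (ι → ℝ) → Ω → ℝ

namespace StatModel

variable {ι κ Ω : Type*} [Fintype ι] [DecidableEq ι] [Fintype κ] [Fintype Ω]

/-- Fisher information matrix
`g_{ij}(θ) = E_θ[∂_i log p_θ · ∂_j log p_θ]`. -/
def fisher (M : StatModel ι Ω) (θ : ι → ℝ) : Matrix ι ι ℝ :=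
  Matrix.of fun i j => ∑ x, M.prob θ x *
    (partialDeriv i (fun η => Real.log (M.prob η x)) θ *
      partialDeriv j (fun η => Real.log (M.prob η x)) θ)

/-- Fisher information volume. -/
def fisherVolume (M : StatModel ι Ω) : ENNReal :=
  riemannianVolume M.fisher M.domain

/-- Amari's map `θ ↦ (2 √(p_θ(x)))_x`. -/
def amariMap (M : StatModel ι Ω) (θ : ι → ℝ) : EuclideanSpace ℝ Ω :=
  WithLp.toLp 2 fun x => 2 * Real.sqrt (M.prob θ x)

/-- `M` and `N` are the same model up to a diffeomorphic change of parameters. -/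
def Equivalent (M : StatModel ι Ω) (N : StatModel κ Ω) : Prop :=
  ∃ (φ : (ι → ℝ) → (κ → ℝ)) (ψ : (κ → ℝ) → (ι → ℝ)),
    ContDiffOn ℝ ∞ φ M.domain ∧ ContDiffOn ℝ ∞ ψ N.domain ∧
    Set.MapsTo φ M.domain N.domain ∧ Set.MapsTo ψ N.domain M.domain ∧
    Set.InvOn ψ φ M.domain N.domain ∧
    ∀ θ ∈ M.domain, N.prob (φ θ) = M.prob θ

end StatModel

/-- The multinomial (categorical) model of all strictly positive probability distributions
on `Ω`, in the standard coordinates: the probabilities of the outcomes other than a reference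
outcome `o`. -/
def multinomialModel {Ω : Type*} [Fintype Ω] [DecidableEq Ω] (o : Ω) :
    StatModel {x : Ω // x ≠ o} Ω where
  domain := {p | (∀ x, 0 < p x) ∧ ∑ x, p x < 1}
  prob p x := if h : x = o then 1 - ∑ y, p y else p ⟨x, h⟩

/-! ## Bitnets -/

/-- A directed acyclic graph; `Adj j k` means that `j` is a parent of `k`. -/
structure DAG (V : Type*) extends Digraph V where
  acyclic : ∀ v, ¬ Relation.TransGen Adj v v

namespace DAG

variable {V : Type*} (G : DAG V)

/-- The parents of a node. -/
abbrev Parents (k : V) : Type _ := {j : V // G.Adj j k}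

/-- Parameter labels `(k, s)`: a node `k` with a configuration `s` of its parents. -/
abbrev Param : Type _ := Σ k : V, (G.Parents k → Bool)

end DAG

/-- The bitnet of a DAG `G` on binary nodes. The parameter `θ (k, s) ∈ (0, 1)` is
`P(X_k = 1 | X_{pa(k)} = s)`, and
`P_θ(x) = ∏_k P(X_k = x_k | X_{pa(k)} = x_{pa(k)})`. -/
def bitnet {V : Type*} [Fintype V] (G : DAG V) : StatModel G.Param (V → Bool) where
  domain := {θ | ∀ a, θ a ∈ Set.Ioo (0 : ℝ) 1}
  prob θ x := ∏ k, if x k then θ ⟨k, fun j => x j⟩ else 1 - θ ⟨k, fun j => x j⟩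

/-- The complete DAG on the `n` ordered nodes `0, …, n - 1`: all edges `j → k` with `j < k`. -/
def completeDAG (n : ℕ) : DAG (Fin n) where
  Adj j k := j < k
  acyclic v h := by
    have key : ∀ a b : Fin n, Relation.TransGen (fun j k : Fin n => j < k) a b → a < b := by
      intro a b hab
      induction hab with
      | single h => exact h
      | tail _ h ih => exact lt_trans ih h
    exact lt_irrefl v (key v v h)

instance (n : ℕ) : DecidableRel (completeDAG n).Adj :=
  fun j k => inferInstanceAs (Decidable (j < k))

/-- The complete bitnet `K̃_n`. -/
abbrev completeBitnet (n : ℕ) : StatModel (completeDAG n).Param (Fin n → Bool) :=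
  bitnet (completeDAG n)

end

/-! The square-root map `θ ↦ 2√p_θ` explains everything. Since `∂(2√p) = ∂p / √p`, the Euclidean
inner products of its partial derivatives are exactly the Fisher matrix, and `∑ p = 1` puts its
image on the sphere of radius `2`. Any model that parametrizes all strictly positive distributions,
smoothly and with smooth inverse, is therefore a chart of the whole open positive orthant of that
sphere. `StatModel.IsSaturated` isolates this property; metric, isometry, volume and curvature are
proved from it alone, so the two parametrizations need no separate geometry.

Curvature is extrinsic. On a sphere `‖y‖² = c` the position vector is the normal, and
differentiating the Gauss formula once more and antisymmetrizing gives constant sectional curvature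
`1 / c`, hence scalar curvature `d (d - 1) / c` with `c = 4`.

Volume is computed by integrating a Gaussian over the positive orthant of `ℝ^Ω` in two ways: as a
product of half-line integrals, and in polar form `y = t · 2√p_θ`, where the Jacobian separates into
`√(det g)` and a power of `t`. Dividing by the radial integral leaves the Fisher volume.

It remains to see that both models are saturated. For the complete bitnet this is the chain rule of
probability: each parameter is a ratio of consecutive marginals, and the product of these ratios
telescopes back to the distribution. -/

noncomputable section

set_option linter.unusedSectionVars false

/-! ### Coordinate partial derivatives of vector-valued maps. -/

section Calculus

variable {ι : Type*} [Fintype ι] [DecidableEq ι]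
variable {E : Type*} [NormedAddCommGroup E]

/-- The partial derivative `∂_a F` of a vector-valued map at `θ`. -/
def vecPartial [NormedSpace ℝ E] (a : ι) (F : (ι → ℝ) → E) (θ : ι → ℝ) : E :=
  fderiv ℝ F θ (Pi.single a 1)

theorem partialDeriv_eq_vecPartial (a : ι) (f : (ι → ℝ) → ℝ) :
    partialDeriv a f = vecPartial a f := rfl

theorem vecPartial_congr [NormedSpace ℝ E] {a : ι} {F G : (ι → ℝ) → E} {U : Set (ι → ℝ)}
    (hU : IsOpen U) (h : ∀ θ ∈ U, F θ = G θ) {θ : ι → ℝ} (hθ : θ ∈ U) :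
    vecPartial a F θ = vecPartial a G θ := by
  have : F =ᶠ[nhds θ] G := by
    filter_upwards [hU.mem_nhds hθ] with η hη using h η hη
  rw [vecPartial, vecPartial, this.fderiv_eq]

theorem vecPartial_const [NormedSpace ℝ E] (a : ι) (c : E) (θ : ι → ℝ) :
    vecPartial a (fun _ => c) θ = 0 := by
  simp [vecPartial]

theorem vecPartial_sum [NormedSpace ℝ E] {κ : Type*} {a : ι} {F : κ → (ι → ℝ) → E}
    {s : Finset κ} {θ : ι → ℝ} (h : ∀ k ∈ s, DifferentiableAt ℝ (F k) θ) :
    vecPartial a (fun η => ∑ k ∈ s, F k η) θ = ∑ k ∈ s, vecPartial a (F k) θ := by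
  simp [vecPartial, fderiv_fun_sum h]

theorem vecPartial_sub [NormedSpace ℝ E] {a : ι} {F G : (ι → ℝ) → E} {θ : ι → ℝ}
    (hF : DifferentiableAt ℝ F θ) (hG : DifferentiableAt ℝ G θ) :
    vecPartial a (fun η => F η - G η) θ = vecPartial a F θ - vecPartial a G θ := by
  simp [vecPartial, fderiv_fun_sub hF hG]

theorem vecPartial_smul [NormedSpace ℝ E] {a : ι} {c : (ι → ℝ) → ℝ} {F : (ι → ℝ) → E}
    {θ : ι → ℝ} (hc : DifferentiableAt ℝ c θ) (hF : DifferentiableAt ℝ F θ) :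
    vecPartial a (fun η => c η • F η) θ
      = vecPartial a c θ • F θ + c θ • vecPartial a F θ := by
  simp [vecPartial, fderiv_fun_smul hc hF, add_comm]

theorem vecPartial_inner [InnerProductSpace ℝ E] {a : ι} {F G : (ι → ℝ) → E} {θ : ι → ℝ}
    (hF : DifferentiableAt ℝ F θ) (hG : DifferentiableAt ℝ G θ) :
    vecPartial a (fun η => inner ℝ (F η) (G η)) θ
      = inner ℝ (vecPartial a F θ) (G θ) + inner ℝ (F θ) (vecPartial a G θ) := by
  simp [vecPartial, fderiv_inner_apply ℝ hF hG, add_comm]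

theorem contDiffOn_vecPartial [NormedSpace ℝ E] {F : (ι → ℝ) → E} {U : Set (ι → ℝ)}
    (hU : IsOpen U) (hF : ContDiffOn ℝ ∞ F U) (a : ι) : ContDiffOn ℝ ∞ (vecPartial a F) U :=
  (hF.fderiv_of_isOpen hU (by simp)).clm_apply contDiffOn_const

theorem ContDiffOn.differentiableAt_of_isOpen [NormedSpace ℝ E] {F : (ι → ℝ) → E}
    {U : Set (ι → ℝ)} (hF : ContDiffOn ℝ ∞ F U) (hU : IsOpen U) {θ : ι → ℝ} (hθ : θ ∈ U) :
    DifferentiableAt ℝ F θ :=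
  (hF.contDiffAt (hU.mem_nhds hθ)).differentiableAt (by simp)

theorem vecPartial_comm [NormedSpace ℝ E] {F : (ι → ℝ) → E} {U : Set (ι → ℝ)}
    (hU : IsOpen U) (hF : ContDiffOn ℝ ∞ F U) (a b : ι) {θ : ι → ℝ} (hθ : θ ∈ U) :
    vecPartial a (vecPartial b F) θ = vecPartial b (vecPartial a F) θ := by
  have hd : DifferentiableAt ℝ (fderiv ℝ F) θ :=
    ((hF.fderiv_of_isOpen (m := ∞) hU (by simp)).contDiffAt
      (hU.mem_nhds hθ)).differentiableAt (by simp)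
  have h2 : ∀ a b : ι, vecPartial a (vecPartial b F) θ
      = fderiv ℝ (fderiv ℝ F) θ (Pi.single a 1) (Pi.single b 1) := by
    intro a b
    have : vecPartial b F = fun η => fderiv ℝ F η (Pi.single b 1) := rfl
    rw [vecPartial, this, fderiv_clm_apply hd (differentiableAt_const _)]
    simp
  rw [h2, h2]
  exact ((hF.contDiffAt (hU.mem_nhds hθ)).isSymmSndFDerivAt
    (by rw [minSmoothness_of_isRCLikeNormedField]; exact WithTop.coe_le_coe.2 le_top)).eq _ _

/-- Cramer's rule: the entries are polynomials in the entries of `g` divided by the nonvanishing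
determinant. -/
theorem contDiffOn_matrix_inv_apply {g : (ι → ℝ) → Matrix ι ι ℝ} {U : Set (ι → ℝ)}
    (hg : ∀ i j, ContDiffOn ℝ ∞ (fun θ => g θ i j) U) (hdet : ∀ θ ∈ U, (g θ).det ≠ 0)
    (i j : ι) : ContDiffOn ℝ ∞ (fun θ => (g θ)⁻¹ i j) U := by
  have hD : ∀ A : (ι → ℝ) → Matrix ι ι ℝ, (∀ i j, ContDiffOn ℝ ∞ (fun θ => A θ i j) U) →
      ContDiffOn ℝ ∞ (fun θ => (A θ).det) U := by
    intro A hA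
    simp only [Matrix.det_apply']
    exact ContDiffOn.sum fun σ _ => contDiffOn_const.mul (contDiffOn_prod fun k _ => hA _ _)
  simp only [Matrix.inv_def, Ring.inverse_eq_inv', Matrix.smul_apply, smul_eq_mul,
    Matrix.adjugate_apply]
  refine ((hD g hg).inv hdet).mul (hD _ fun a b => ?_)
  by_cases h : a = j
  · subst h; simpa using contDiffOn_const
  · simpa [Matrix.updateRow_ne h] using hg a b

end Calculus

/-! ### Extrinsic curvature of hypersurface charts in a sphere. -/

section Gauss

variable {ι : Type*} [Fintype ι] [DecidableEq ι]
variable {E : Type*} [NormedAddCommGroup E] [InnerProductSpace ℝ E]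

/-- `F` immerses the open set `U` as a hypersurface of the sphere `‖y‖² = c`, and `g` is the
induced metric. -/
structure IsSphericalChart (g : (ι → ℝ) → Matrix ι ι ℝ) (U : Set (ι → ℝ)) (F : (ι → ℝ) → E)
    (c : ℝ) : Prop where
  isOpen : IsOpen U
  smooth : ContDiffOn ℝ ∞ F U
  metric : ∀ θ ∈ U, ∀ i j, g θ i j = inner ℝ (vecPartial i F θ) (vecPartial j F θ)
  posDef : ∀ θ ∈ U, (g θ).PosDef
  norm_sq : ∀ θ ∈ U, inner ℝ (F θ) (F θ) = c
  pos : 0 < c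
  finrank : Module.finrank ℝ E = Fintype.card ι + 1

namespace IsSphericalChart

variable {g : (ι → ℝ) → Matrix ι ι ℝ} {U : Set (ι → ℝ)} {F : (ι → ℝ) → E} {c : ℝ}

theorem smooth_metric (h : IsSphericalChart g U F c) (i j : ι) :
    ContDiffOn ℝ ∞ (fun θ => g θ i j) U :=
  ((contDiffOn_vecPartial h.isOpen h.smooth i).inner ℝ
    (contDiffOn_vecPartial h.isOpen h.smooth j)).congr fun θ hθ => h.metric θ hθ i j

/-- Differentiate the constant `⟨F, F⟩ = c`. -/
theorem inner_partial_self (h : IsSphericalChart g U F c) {θ : ι → ℝ} (hθ : θ ∈ U) (i : ι) :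
    inner ℝ (vecPartial i F θ) (F θ) = 0 := by
  have hF := h.smooth.differentiableAt_of_isOpen h.isOpen hθ
  have h1 := vecPartial_inner (a := i) hF hF
  rw [vecPartial_congr h.isOpen h.norm_sq hθ, vecPartial_const, real_inner_comm] at h1
  rw [real_inner_comm]
  linarith

/-- Differentiating `⟨∂_j F, F⟩ = 0` gives the second fundamental form: up to a factor, it is the
metric itself. -/
theorem inner_second_partial_self (h : IsSphericalChart g U F c) {θ : ι → ℝ} (hθ : θ ∈ U)
    (i j : ι) : inner ℝ (vecPartial i (vecPartial j F) θ) (F θ) = - g θ i j := by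
  have hF := h.smooth.differentiableAt_of_isOpen h.isOpen hθ
  have hjF := (contDiffOn_vecPartial h.isOpen h.smooth j).differentiableAt_of_isOpen h.isOpen hθ
  have h1 := vecPartial_inner (a := i) hjF hF
  rw [vecPartial_congr h.isOpen (fun θ hθ => h.inner_partial_self hθ j) hθ, vecPartial_const]
    at h1
  rw [h.metric θ hθ, real_inner_comm (vecPartial j F θ)]
  linarith

/-- Pairing with `F` kills the tangential part and isolates `b`; pairing with the `∂_k F` then gives
`g a = 0`, which positive definiteness excludes unless `a = 0`. -/
theorem linear_combination_eq_zero (h : IsSphericalChart g U F c) {θ : ι → ℝ} (hθ : θ ∈ U)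
    {a : ι → ℝ} {b : ℝ} (h0 : ∑ l, a l • vecPartial l F θ + b • F θ = 0) : a = 0 ∧ b = 0 := by
  have hb : b = 0 := by
    have := congrArg (fun v => inner ℝ v (F θ)) h0
    simp only [inner_add_left, sum_inner, inner_smul_left, h.inner_partial_self hθ,
      h.norm_sq θ hθ, inner_zero_left] at this
    simpa [h.pos.ne'] using this
  refine ⟨?_, hb⟩
  by_contra ha
  have hp := (h.posDef θ hθ).dotProduct_mulVec_pos ha
  have hz : ∀ k, (g θ).mulVec a k = 0 := by
    intro k
    have := congrArg (fun v => inner ℝ (vecPartial k F θ) v) h0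
    simp only [hb, zero_smul, add_zero, inner_sum, inner_smul_right, ← h.metric θ hθ,
      inner_zero_right] at this
    rw [← this, Matrix.mulVec, dotProduct]
    exact Finset.sum_congr rfl fun l _ => mul_comm _ _
  rw [show (g θ).mulVec a = 0 from funext hz] at hp
  simp at hp

/-- Codimension one enters here: the tangent vectors together with `F` are `card ι + 1` independent
vectors, hence a basis, so a vector identity may be tested against them. -/
theorem eq_zero_of_orthogonal (h : IsSphericalChart g U F c) {θ : ι → ℝ} (hθ : θ ∈ U)
    {v : E} (hv : ∀ i, inner ℝ v (vecPartial i F θ) = 0) (hv' : inner ℝ v (F θ) = 0) :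
    v = 0 := by
  have : FiniteDimensional ℝ E := Module.finite_of_finrank_pos (by rw [h.finrank]; omega)
  let b : Option ι → E := fun o => o.elim (F θ) fun i => vecPartial i F θ
  have hli : LinearIndependent ℝ b := by
    rw [Fintype.linearIndependent_iff]
    intro a ha
    rw [Fintype.sum_option, add_comm] at ha
    obtain ⟨h1, h2⟩ := h.linear_combination_eq_zero hθ (a := fun i => a (some i)) ha
    rintro (_ | i)
    · exact h2
    · exact congrFun h1 i
  have hspan := hli.span_eq_top_of_card_eq_finrank (by rw [h.finrank, Fintype.card_option])
  refine inner_self_eq_zero (𝕜 := ℝ).1 ?_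
  have hmem : v ∈ Submodule.span ℝ (Set.range b) := hspan ▸ Submodule.mem_top
  have hle : Submodule.span ℝ (Set.range b) ≤ (ℝ ∙ v)ᗮ := by
    rw [Submodule.span_le]
    rintro _ ⟨(_ | i), rfl⟩
    · exact Submodule.mem_orthogonal_singleton_iff_inner_right.2 hv'
    · exact Submodule.mem_orthogonal_singleton_iff_inner_right.2 (hv i)
  exact Submodule.mem_orthogonal_singleton_iff_inner_right.1 (hle hmem)

theorem inv_mul_metric (h : IsSphericalChart g U F c) {θ : ι → ℝ} (hθ : θ ∈ U) :
    (g θ)⁻¹ * g θ = 1 :=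
  Matrix.nonsing_inv_mul _ ((h.posDef θ hθ).det_pos.ne'.isUnit)

/-- Expanding each `∂g` by the product rule, the terms with `∂_l ∂_i F` and `∂_l ∂_j F` cancel by
symmetry of second derivatives and `⟨∂_i ∂_j F, ∂_l F⟩` survives twice. -/
theorem christoffel_eq (h : IsSphericalChart g U F c) {θ : ι → ℝ} (hθ : θ ∈ U) (k i j : ι) :
    christoffel g k i j θ
      = ∑ l, (g θ)⁻¹ k l * inner ℝ (vecPartial i (vecPartial j F) θ) (vecPartial l F θ) := by
  have hd : ∀ a, DifferentiableAt ℝ (vecPartial a F) θ := fun a =>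
    (contDiffOn_vecPartial h.isOpen h.smooth a).differentiableAt_of_isOpen h.isOpen hθ
  have hp : ∀ a b d, partialDeriv a (fun η => g η b d) θ
      = inner ℝ (vecPartial a (vecPartial b F) θ) (vecPartial d F θ)
        + inner ℝ (vecPartial a (vecPartial d F) θ) (vecPartial b F θ) := by
    intro a b d
    rw [partialDeriv_eq_vecPartial, vecPartial_congr h.isOpen (fun η hη => h.metric η hη b d) hθ,
      vecPartial_inner (hd b) (hd d), real_inner_comm (vecPartial b F θ)]
  rw [christoffel, Finset.mul_sum]
  refine Finset.sum_congr rfl fun l _ => ?_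
  rw [hp, hp, hp, vecPartial_comm h.isOpen h.smooth l i hθ,
    vecPartial_comm h.isOpen h.smooth l j hθ, vecPartial_comm h.isOpen h.smooth j i hθ]
  ring

theorem contDiffOn_christoffel (h : IsSphericalChart g U F c) (k i j : ι) :
    ContDiffOn ℝ ∞ (christoffel g k i j) U := by
  have hs := contDiffOn_vecPartial h.isOpen h.smooth
  refine ContDiffOn.congr (ContDiffOn.sum fun l _ => ?_) fun θ hθ => h.christoffel_eq hθ k i j
  exact (contDiffOn_matrix_inv_apply h.smooth_metric (fun θ hθ => (h.posDef θ hθ).det_pos.ne')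
    k l).mul ((contDiffOn_vecPartial h.isOpen (hs j) i).inner ℝ (hs l))

/-- The Gauss formula `∂_i ∂_j F = ∑_l Γ^l_{ij} ∂_l F - (g_{ij} / c) F`. -/
theorem gauss_formula (h : IsSphericalChart g U F c) {θ : ι → ℝ} (hθ : θ ∈ U) (i j : ι) :
    vecPartial i (vecPartial j F) θ
      = ∑ l, christoffel g l i j θ • vecPartial l F θ - (c⁻¹ * g θ i j) • F θ := by
  rw [← sub_eq_zero]
  refine h.eq_zero_of_orthogonal hθ (fun m => ?_) ?_
  · have hF0 : inner ℝ (F θ) (vecPartial m F θ) = 0 := by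
      rw [real_inner_comm, h.inner_partial_self hθ]
    simp only [inner_sub_left, sum_inner, real_inner_smul_left, hF0, mul_zero, sub_zero,
      ← h.metric θ hθ, h.christoffel_eq hθ]
    rw [sub_eq_zero]
    simp only [Finset.sum_mul]
    rw [Finset.sum_comm]
    have h1 : ∀ l, ∑ x, (g θ)⁻¹ x l * inner ℝ (vecPartial i (vecPartial j F) θ)
        (vecPartial l F θ) * g θ x m = inner ℝ (vecPartial i (vecPartial j F) θ)
        (vecPartial l F θ) * (1 : Matrix ι ι ℝ) l m := by
      intro l
      rw [← h.inv_mul_metric hθ, Matrix.mul_apply, Finset.mul_sum]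
      refine Finset.sum_congr rfl fun x _ => ?_
      have hinv : (g θ)⁻¹ x l = (g θ)⁻¹ l x := by
        simpa using ((h.posDef θ hθ).1.inv.apply l x)
      rw [hinv]; ring
    simp [h1, Matrix.one_apply]
  · simp only [inner_sub_left, sum_inner, real_inner_smul_left, h.inner_partial_self hθ,
      h.norm_sq θ hθ, h.inner_second_partial_self hθ, mul_zero, Finset.sum_const_zero]
    field_simp [h.pos.ne']
    ring

/-- The curvature tensor of a spherical chart has constant sectional curvature `1 / c`. -/
theorem riemannTensor_eq (h : IsSphericalChart g U F c) {θ : ι → ℝ} (hθ : θ ∈ U)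
    (l k i j : ι) : riemannTensor g l k i j θ
      = c⁻¹ * (g θ j k * (1 : Matrix ι ι ℝ) l i - g θ i k * (1 : Matrix ι ι ℝ) l j) := by
  have hs := contDiffOn_vecPartial h.isOpen h.smooth
  have hd : ∀ a, DifferentiableAt ℝ (vecPartial a F) θ := fun a =>
    (hs a).differentiableAt_of_isOpen h.isOpen hθ
  have hdF := h.smooth.differentiableAt_of_isOpen h.isOpen hθ
  have hdC : ∀ a b d, DifferentiableAt ℝ (christoffel g a b d) θ := fun a b d =>
    (h.contDiffOn_christoffel a b d).differentiableAt_of_isOpen h.isOpen hθ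
  have hdg : ∀ b d, DifferentiableAt ℝ (fun η => c⁻¹ * g η b d) θ := fun b d =>
    ((h.smooth_metric b d).differentiableAt_of_isOpen h.isOpen hθ).const_mul _
  -- Tangential coefficients of `∂_a ∂_b ∂_k F` after inserting the Gauss formula twice. The normal
  -- coefficient is left unspecified, since only tangential components are compared.
  let C : ι → ι → ι → ℝ := fun a b l => partialDeriv a (christoffel g l b k) θ
    + ∑ m, christoffel g l a m θ * christoffel g m b k θ
    - c⁻¹ * (g θ b k * (1 : Matrix ι ι ℝ) l a)
  have key : ∀ a b, ∃ r : ℝ, vecPartial a (vecPartial b (vecPartial k F)) θ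
      = ∑ l, C a b l • vecPartial l F θ + r • F θ := by
    intro a b
    rw [vecPartial_congr h.isOpen (fun η hη => h.gauss_formula hη b k) hθ,
      vecPartial_sub (DifferentiableAt.fun_sum fun m _ => (hdC _ _ _).fun_smul (hd m))
        ((hdg b k).fun_smul hdF),
      vecPartial_sum (fun m _ => (hdC _ _ _).fun_smul (hd m)), vecPartial_smul (hdg b k) hdF]
    simp only [fun m => vecPartial_smul (a := a) (hdC m b k) (hd m), h.gauss_formula hθ]
    refine ⟨-(∑ m, christoffel g m b k θ * (c⁻¹ * g θ a m))
      - vecPartial a (fun η => c⁻¹ * g η b k) θ, ?_⟩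
    have e1 : ∑ l, (c⁻¹ * (g θ b k * (1 : Matrix ι ι ℝ) l a)) • vecPartial l F θ
        = (c⁻¹ * g θ b k) • vecPartial a F θ := by
      simp [Matrix.one_apply]
    have e2 : ∑ l, (∑ m, christoffel g l a m θ * christoffel g m b k θ) • vecPartial l F θ
        = ∑ m, christoffel g m b k θ • ∑ l, christoffel g l a m θ • vecPartial l F θ := by
      simp only [Finset.sum_smul, Finset.smul_sum, smul_smul]
      rw [Finset.sum_comm]
      simp only [mul_comm]
    have e3 : (∑ m, christoffel g m b k θ * (c⁻¹ * g θ a m)) • F θ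
        = ∑ m, (christoffel g m b k θ * (c⁻¹ * g θ a m)) • F θ := Finset.sum_smul
    simp only [C, add_smul, sub_smul, smul_sub, Finset.sum_add_distrib, Finset.sum_sub_distrib, e1,
      e2, e3, neg_smul, smul_smul, partialDeriv_eq_vecPartial]
    abel
  obtain ⟨r₁, h₁⟩ := key i j
  obtain ⟨r₂, h₂⟩ := key j i
  -- Third derivatives commute in `i, j`, so `C i j = C j i`; this symmetry is the Gauss equation.
  rw [vecPartial_comm h.isOpen (hs k) i j hθ, h₂, ← sub_eq_zero] at h₁
  have h0 := (h.linear_combination_eq_zero hθ (b := r₂ - r₁) (a := C j i - C i j) (by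
    rw [← h₁]
    simp only [Pi.sub_apply, sub_smul, Finset.sum_sub_distrib]
    abel)).1
  have h3 := congrFun h0 l
  simp only [Pi.zero_apply, Pi.sub_apply, C] at h3
  rw [riemannTensor, Finset.sum_sub_distrib]
  linarith

theorem ricciTensor_eq (h : IsSphericalChart g U F c) {θ : ι → ℝ} (hθ : θ ∈ U) (k j : ι) :
    ricciTensor g k j θ = c⁻¹ * (Fintype.card ι - 1) * g θ j k := by
  simp only [ricciTensor, h.riemannTensor_eq hθ, ← Finset.mul_sum, Finset.sum_sub_distrib]
  simp [Matrix.one_apply]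
  ring

/-- The Ricci scalar of a spherical chart of dimension `d` on `‖y‖² = c` is `d (d - 1) / c`. -/
theorem ricciScalar_eq (h : IsSphericalChart g U F c) {θ : ι → ℝ} (hθ : θ ∈ U) :
    ricciScalar g θ = Fintype.card ι * (Fintype.card ι - 1) / c := by
  have : ∀ k, ∑ j, (g θ)⁻¹ k j * ricciTensor g k j θ = c⁻¹ * (Fintype.card ι - 1) := by
    intro k
    have h1 : ∑ j, (g θ)⁻¹ k j * g θ j k = 1 := by
      rw [← Matrix.mul_apply, h.inv_mul_metric hθ, Matrix.one_apply_eq]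
    calc _ = c⁻¹ * (Fintype.card ι - 1) * ∑ j, (g θ)⁻¹ k j * g θ j k := by
          rw [Finset.mul_sum]
          exact Finset.sum_congr rfl fun j _ => by rw [h.ricciTensor_eq hθ]; ring
      _ = _ := by rw [h1, mul_one]
  simp only [ricciScalar, this, Finset.sum_const, Finset.card_univ, nsmul_eq_mul]
  ring

end IsSphericalChart

end Gauss

/-! ### Fisher geometry of models containing every positive distribution. -/

section Saturated

variable {ι κ Ω : Type*} [Fintype ι] [DecidableEq ι] [Fintype κ] [DecidableEq κ] [Fintype Ω]

/-- `M` is a smooth parametrization of all strictly positive probability distributions on `Ω`;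
the inverse of the parametrization is the restriction of the map `G`, smooth on the positive
orthant. -/
structure StatModel.IsSaturated (M : StatModel ι Ω) (G : (Ω → ℝ) → ι → ℝ) : Prop where
  isOpen : IsOpen M.domain
  smooth : ∀ x, ContDiffOn ℝ ∞ (fun θ => M.prob θ x) M.domain
  pos : ∀ θ ∈ M.domain, ∀ x, 0 < M.prob θ x
  sum_eq_one : ∀ θ ∈ M.domain, ∑ x, M.prob θ x = 1
  smooth_inverse : ContDiffOn ℝ ∞ G {q | ∀ x, 0 < q x}
  left_inv : ∀ θ ∈ M.domain, G (M.prob θ) = θ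
  mem_domain : ∀ q : Ω → ℝ, (∀ x, 0 < q x) → ∑ x, q x = 1 → G q ∈ M.domain
  right_inv : ∀ q : Ω → ℝ, (∀ x, 0 < q x) → ∑ x, q x = 1 → M.prob (G q) = q

theorem fderiv_eq_sum_vecPartial {E : Type*} [NormedAddCommGroup E] [NormedSpace ℝ E]
    (F : (ι → ℝ) → E) (θ u : ι → ℝ) : fderiv ℝ F θ u = ∑ i, u i • vecPartial i F θ := by
  conv_lhs => rw [pi_eq_sum_univ' u]
  simp [vecPartial]

namespace StatModel.IsSaturated

variable {M : StatModel ι Ω} {G : (Ω → ℝ) → ι → ℝ} {N : StatModel κ Ω} {H : (Ω → ℝ) → κ → ℝ}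

/-- Two saturated models on the same sample space are equivalent. -/
theorem equivalent (hM : M.IsSaturated G) (hN : N.IsSaturated H) : M.Equivalent N := by
  refine ⟨fun θ => H (M.prob θ), fun η => G (N.prob η), ?_, ?_, ?_, ?_, ⟨?_, ?_⟩, ?_⟩
  · exact hN.smooth_inverse.comp (contDiffOn_pi.2 hM.smooth) hM.pos
  · exact hM.smooth_inverse.comp (contDiffOn_pi.2 hN.smooth) hN.pos
  · exact fun θ hθ => hN.mem_domain _ (hM.pos θ hθ) (hM.sum_eq_one θ hθ)
  · exact fun θ hθ => hM.mem_domain _ (hN.pos θ hθ) (hN.sum_eq_one θ hθ)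
  · intro θ hθ
    simp only [hN.right_inv _ (hM.pos θ hθ) (hM.sum_eq_one θ hθ), hM.left_inv θ hθ]
  · intro θ hθ
    simp only [hM.right_inv _ (hN.pos θ hθ) (hN.sum_eq_one θ hθ), hN.left_inv θ hθ]
  · exact fun θ hθ => hN.right_inv _ (hM.pos θ hθ) (hM.sum_eq_one θ hθ)

theorem contDiffOn_amariMap (hM : M.IsSaturated G) : ContDiffOn ℝ ∞ M.amariMap M.domain := by
  rw [contDiffOn_euclidean]
  exact fun x => contDiffOn_const.mul ((hM.smooth x).sqrt fun θ hθ => (hM.pos θ hθ x).ne')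

theorem amariMap_pos (hM : M.IsSaturated G) {θ : ι → ℝ} (hθ : θ ∈ M.domain) (x : Ω) :
    0 < M.amariMap θ x :=
  mul_pos two_pos (Real.sqrt_pos.2 (hM.pos θ hθ x))

theorem amariMap_sq (hM : M.IsSaturated G) {θ : ι → ℝ} (hθ : θ ∈ M.domain) (x : Ω) :
    M.amariMap θ x ^ 2 = 4 * M.prob θ x := by
  simp only [amariMap, mul_pow, Real.sq_sqrt (hM.pos θ hθ x).le]
  norm_num

theorem inner_amariMap_self (hM : M.IsSaturated G) {θ : ι → ℝ} (hθ : θ ∈ M.domain) :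
    inner ℝ (M.amariMap θ) (M.amariMap θ) = 4 := by
  rw [real_inner_self_eq_norm_sq, EuclideanSpace.real_norm_sq_eq]
  simp only [hM.amariMap_sq hθ, ← Finset.mul_sum, hM.sum_eq_one θ hθ, mul_one]

theorem vecPartial_amariMap_apply (hM : M.IsSaturated G) {θ : ι → ℝ} (hθ : θ ∈ M.domain)
    (i : ι) (x : Ω) : vecPartial i M.amariMap θ x
      = partialDeriv i (fun η => M.prob η x) θ / Real.sqrt (M.prob θ x) := by
  have hF := hM.contDiffOn_amariMap.differentiableAt_of_isOpen hM.isOpen hθ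
  have hp := (hM.smooth x).differentiableAt_of_isOpen hM.isOpen hθ
  have h1 : HasFDerivAt (fun η => M.amariMap η x)
      ((EuclideanSpace.proj x : EuclideanSpace ℝ Ω →L[ℝ] ℝ).comp (fderiv ℝ M.amariMap θ)) θ :=
    (EuclideanSpace.proj x : EuclideanSpace ℝ Ω →L[ℝ] ℝ).hasFDerivAt.comp θ hF.hasFDerivAt
  have h2 : HasFDerivAt (fun η => M.amariMap η x) _ θ :=
    (hp.hasFDerivAt.sqrt (hM.pos θ hθ x).ne').const_mul 2
  have h3 := DFunLike.congr_fun (h1.unique h2) (Pi.single i 1)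
  rw [vecPartial, partialDeriv]
  refine h3.trans ?_
  simp only [smul_apply, smul_eq_mul]
  field_simp

/-- Termwise, `p · (∂_i p / p)(∂_j p / p) = (∂_i p / √p)(∂_j p / √p)`. -/
theorem fisher_apply (hM : M.IsSaturated G) {θ : ι → ℝ} (hθ : θ ∈ M.domain) (i j : ι) :
    M.fisher θ i j = inner ℝ (vecPartial i M.amariMap θ) (vecPartial j M.amariMap θ) := by
  have hl : ∀ a x, partialDeriv a (fun η => Real.log (M.prob η x)) θ
      = (M.prob θ x)⁻¹ * partialDeriv a (fun η => M.prob η x) θ := by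
    intro a x
    rw [partialDeriv, fderiv.log ((hM.smooth x).differentiableAt_of_isOpen hM.isOpen hθ)
      (hM.pos θ hθ x).ne']
    rfl
  simp only [fisher, Matrix.of_apply, PiLp.inner_apply, hM.vecPartial_amariMap_apply hθ, hl]
  refine Finset.sum_congr rfl fun x _ => ?_
  have h0 := hM.pos θ hθ x
  have hs := Real.mul_self_sqrt h0.le
  have hs0 := Real.sqrt_pos.2 h0
  simp only [RCLike.inner_apply, conj_trivial]
  rw [div_mul_div_comm, hs]
  field_simp

theorem pullback (hM : M.IsSaturated G) {θ : ι → ℝ} (hθ : θ ∈ M.domain) (u v : ι → ℝ) :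
    inner ℝ (fderiv ℝ M.amariMap θ u) (fderiv ℝ M.amariMap θ v)
      = ∑ i, ∑ j, u i * M.fisher θ i j * v j := by
  simp only [fderiv_eq_sum_vecPartial M.amariMap, sum_inner, real_inner_smul_left,
    hM.fisher_apply hθ]
  simp only [inner_sum, real_inner_smul_right, Finset.mul_sum]
  refine Finset.sum_congr rfl fun i _ => Finset.sum_congr rfl fun j _ => by ring

/-- A smooth left inverse of Amari's map. -/
theorem exists_left_inverse (hM : M.IsSaturated G) :
    ContDiffOn ℝ ∞ (fun y : EuclideanSpace ℝ Ω => G fun x => y x ^ 2 / 4) {y | ∀ x, 0 < y x} ∧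
    ∀ θ ∈ M.domain, G (fun x => M.amariMap θ x ^ 2 / 4) = θ := by
  constructor
  · refine hM.smooth_inverse.comp (contDiffOn_pi.2 fun x => ?_) fun y hy x => ?_
    · exact (((EuclideanSpace.proj x : EuclideanSpace ℝ Ω →L[ℝ] ℝ).contDiff.pow 2).div_const
        4).contDiffOn
    · have := hy x
      positivity
  · intro θ hθ
    have : (fun x => M.amariMap θ x ^ 2 / 4) = M.prob θ := by
      funext x
      rw [hM.amariMap_sq hθ]; ring
    rw [this, hM.left_inv θ hθ]

theorem isOpen_positive : IsOpen {y : EuclideanSpace ℝ Ω | ∀ x, 0 < y x} := by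
  simp only [Set.ofPred_forall]
  exact isOpen_iInter_of_finite fun x =>
    isOpen_lt continuous_const (EuclideanSpace.proj x : EuclideanSpace ℝ Ω →L[ℝ] ℝ).continuous

/-- By the chain rule the derivative of a smooth left inverse is a left inverse of the derivative.
This is what makes the Fisher matrix definite rather than semidefinite. -/
theorem fderiv_amariMap_injective (hM : M.IsSaturated G) {θ : ι → ℝ} (hθ : θ ∈ M.domain) :
    Function.Injective (fderiv ℝ M.amariMap θ) := by
  obtain ⟨h1, h2⟩ := hM.exists_left_inverse
  have hF := (hM.contDiffOn_amariMap.differentiableAt_of_isOpen hM.isOpen hθ).hasFDerivAt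
  have hG := ((h1.contDiffAt (isOpen_positive.mem_nhds (hM.amariMap_pos hθ))).differentiableAt
    (by simp)).hasFDerivAt
  have hc := hG.comp θ hF
  have hid : HasFDerivAt ((fun y : EuclideanSpace ℝ Ω => G fun x => y x ^ 2 / 4) ∘ M.amariMap)
      (ContinuousLinearMap.id ℝ (ι → ℝ)) θ := by
    refine (hasFDerivAt_id θ).congr_of_eventuallyEq ?_
    filter_upwards [hM.isOpen.mem_nhds hθ] with η hη using h2 η hη
  have he := hc.unique hid
  intro u v huv
  have hu := DFunLike.congr_fun he u
  have hv := DFunLike.congr_fun he v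
  simp only [ContinuousLinearMap.comp_apply, ContinuousLinearMap.id_apply] at hu hv
  rw [← hu, ← hv, huv]

theorem posDef_fisher (hM : M.IsSaturated G) {θ : ι → ℝ} (hθ : θ ∈ M.domain) :
    (M.fisher θ).PosDef := by
  refine Matrix.PosDef.of_dotProduct_mulVec_pos ?_ fun v hv => ?_
  · ext i j
    rw [Matrix.conjTranspose_apply, star_trivial, hM.fisher_apply hθ, hM.fisher_apply hθ,
      real_inner_comm]
  · have h1 : star v ⬝ᵥ (M.fisher θ).mulVec v
        = inner ℝ (fderiv ℝ M.amariMap θ v) (fderiv ℝ M.amariMap θ v) := by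
      rw [hM.pullback hθ]
      simp only [dotProduct, Matrix.mulVec, star_trivial, Finset.mul_sum, mul_assoc]
    rw [h1]
    refine real_inner_self_pos.2 fun h0 => hv ?_
    exact hM.fderiv_amariMap_injective hθ (h0.trans (map_zero _).symm)

/-- Amari's map is a chart of the sphere of radius `2`, with the Fisher matrix as induced
metric. -/
theorem isSphericalChart (hM : M.IsSaturated G) (hcard : Fintype.card Ω = Fintype.card ι + 1) :
    IsSphericalChart M.fisher M.domain M.amariMap 4 where
  isOpen := hM.isOpen
  smooth := hM.contDiffOn_amariMap
  metric _ hθ := hM.fisher_apply hθ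
  posDef _ hθ := hM.posDef_fisher hθ
  norm_sq _ hθ := hM.inner_amariMap_self hθ
  pos := by norm_num
  finrank := by rw [finrank_euclideanSpace, hcard]

theorem isRiemannianMetricOn (hM : M.IsSaturated G)
    (hcard : Fintype.card Ω = Fintype.card ι + 1) :
    IsRiemannianMetricOn M.fisher M.domain :=
  ⟨(hM.isSphericalChart hcard).smooth_metric, fun _ hθ => hM.posDef_fisher hθ⟩

theorem isIsometryOnto (hM : M.IsSaturated G) :
    IsIsometryOnto M.fisher M.domain M.amariMap (positiveSphereOrthant Ω 2) where
  smooth := hM.contDiffOn_amariMap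
  bijOn := by
    refine ⟨fun θ hθ => ⟨?_, hM.amariMap_pos hθ⟩, fun θ hθ η hη h => ?_, ?_⟩
    · rw [mem_sphere_zero_iff_norm]
      have := hM.inner_amariMap_self hθ
      rw [real_inner_self_eq_norm_sq] at this
      nlinarith [norm_nonneg (M.amariMap θ)]
    · rw [← hM.exists_left_inverse.2 θ hθ, ← hM.exists_left_inverse.2 η hη, h]
    · rintro y ⟨hy, hpos⟩
      have hq : ∀ x, 0 < y x ^ 2 / 4 := fun x => by have := hpos x; positivity
      have hsum : ∑ x, y x ^ 2 / 4 = 1 := by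
        rw [← Finset.sum_div, ← EuclideanSpace.real_norm_sq_eq, mem_sphere_zero_iff_norm.1 hy]
        norm_num
      refine ⟨G fun x => y x ^ 2 / 4, hM.mem_domain _ hq hsum, ?_⟩
      ext x
      simp only [amariMap, hM.right_inv _ hq hsum]
      rw [show y x ^ 2 / 4 = (y x / 2) ^ 2 by ring, Real.sqrt_sq (by have := hpos x; positivity)]
      ring
  smooth_inverse := ⟨_, _, isOpen_positive, fun _ hy => hy.2, hM.exists_left_inverse.1,
    hM.exists_left_inverse.2⟩
  pullback _ hθ := hM.pullback hθ

theorem ricciScalar_fisher (hM : M.IsSaturated G)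
    (hcard : Fintype.card Ω = Fintype.card ι + 1) {θ : ι → ℝ} (hθ : θ ∈ M.domain) :
    ricciScalar M.fisher θ = Fintype.card ι * (Fintype.card ι - 1) / 4 :=
  (hM.isSphericalChart hcard).ricciScalar_eq hθ

end StatModel.IsSaturated

end Saturated

/-! ### Gaussian integrals and separation of variables. -/

section GaussianIntegrals

theorem lintegral_orthant_exp_neg_sum_sq (κ : Type*) [Fintype κ] :
    ∫⁻ y in Set.univ.pi fun _ : κ => Set.Ioi (0 : ℝ), ENNReal.ofReal (Real.exp (-∑ a, y a ^ 2))
      = ENNReal.ofReal ((Real.sqrt Real.pi / 2) ^ Fintype.card κ) := by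
  have hint : Integrable (fun x : ℝ => Real.exp (-1 * x ^ 2)) (volume.restrict (Set.Ioi 0)) :=
    (integrable_exp_neg_mul_sq one_pos).restrict
  have he : ∀ y : κ → ℝ, Real.exp (-∑ a, y a ^ 2) = ∏ a, Real.exp (-1 * y a ^ 2) := by
    intro y
    rw [← Real.exp_sum, ← Finset.mul_sum, neg_one_mul]
  rw [volume_pi, Measure.restrict_pi_pi]
  simp only [he]
  rw [← ofReal_integral_eq_lintegral_ofReal (Integrable.fintype_prod fun _ => hint)
      (Filter.Eventually.of_forall fun y => Finset.prod_nonneg fun a _ => (Real.exp_pos _).le),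
    integral_fintype_prod_eq_pow (fun x : ℝ => Real.exp (-1 * x ^ 2)), integral_gaussian_Ioi,
    div_one]

theorem lintegral_radial_gaussian (d : ℕ) :
    ∫⁻ t in Set.Ioi (0 : ℝ), ENNReal.ofReal (2 * t ^ d * Real.exp (-(4 * t ^ 2)))
      = ENNReal.ofReal (Real.Gamma ((d + 1 : ℕ) / 2) / 2 ^ (d + 1)) := by
  have hG : 0 < Real.Gamma (((d + 1 : ℕ) : ℝ) / 2) := Real.Gamma_pos_of_pos (by positivity)
  have h4 : (4 : ℝ) ^ (-((d : ℝ) + 1) / 2) = (2 ^ (d + 1))⁻¹ := by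
    rw [show (4 : ℝ) = 2 ^ (2 : ℝ) by norm_num, ← Real.rpow_mul (by norm_num), ← Real.rpow_natCast,
      ← Real.rpow_neg (by norm_num)]
    congr 1
    push_cast; ring
  have hI : ∫ t in Set.Ioi (0 : ℝ), 2 * t ^ d * Real.exp (-(4 * t ^ 2))
      = Real.Gamma ((d + 1 : ℕ) / 2) / 2 ^ (d + 1) := by
    have h := integral_rpow_mul_exp_neg_mul_rpow (p := 2) (q := d) (b := 4) two_pos
      (by have : (0 : ℝ) ≤ d := d.cast_nonneg; linarith) (by norm_num)
    simp only [Real.rpow_natCast, Real.rpow_two, neg_mul] at h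
    simp only [mul_assoc]
    rw [integral_const_mul, h, h4]
    push_cast
    ring
  rw [← hI, ofReal_integral_eq_lintegral_ofReal]
  -- Integrability follows from the value: the Bochner integral of a non-integrable function is `0`,
  -- but this one is positive.
  · by_contra hn
    rw [integral_undef hn] at hI
    have : 0 < Real.Gamma (((d + 1 : ℕ) : ℝ) / 2) / 2 ^ (d + 1) := by positivity
    exact this.ne hI
  · filter_upwards [ae_restrict_mem measurableSet_Ioi] with t ht
    have : 0 < t := ht
    simp only [Pi.zero_apply]
    positivity

theorem setLIntegral_sum_unit_mul {ι : Type*} [Fintype ι] {U : Set (ι → ℝ)} {T : Set ℝ}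
    {f : (ι → ℝ) → ENNReal} {h : ℝ → ENNReal} (hf : AEMeasurable f (volume.restrict U))
    (hh : AEMeasurable h (volume.restrict T)) :
    ∫⁻ z in {z : ι ⊕ Unit → ℝ | (fun i => z (Sum.inl i)) ∈ U ∧ z (Sum.inr ()) ∈ T},
      f (fun i => z (Sum.inl i)) * h (z (Sum.inr ())) = (∫⁻ θ in U, f θ) * ∫⁻ t in T, h t := by
  let e : (ι ⊕ Unit → ℝ) ≃ᵐ (ι → ℝ) × ℝ :=
    (MeasurableEquiv.sumPiEquivProdPi fun _ : ι ⊕ Unit => ℝ).trans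
      (MeasurableEquiv.prodCongr (MeasurableEquiv.refl _) (MeasurableEquiv.funUnique Unit ℝ))
  have he : MeasurePreserving e volume (volume.prod volume) :=
    ((MeasurePreserving.id volume).prod (volume_preserving_funUnique Unit ℝ)).comp
      (volume_measurePreserving_sumPiEquivProdPi fun _ : ι ⊕ Unit => ℝ)
  rw [← lintegral_prod_mul hf hh, Measure.prod_restrict,
    ← he.setLIntegral_comp_preimage_emb e.measurableEmbedding (fun p => f p.1 * h p.2)]
  rfl

end GaussianIntegrals

/-! ### Fisher volume by polar coordinates over the orthant. -/

namespace StatModel.IsSaturated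

variable {ι Ω : Type*} [Fintype ι] [DecidableEq ι] [Fintype Ω]
variable {M : StatModel ι Ω} {G : (Ω → ℝ) → ι → ℝ}

/-- The cone over Amari's map, in the coordinates of `ι ⊕ Unit ≃ Ω`. -/
def cone (M : StatModel ι Ω) (e : ι ⊕ Unit ≃ Ω) (z : ι ⊕ Unit → ℝ) (a : ι ⊕ Unit) : ℝ :=
  z (Sum.inr ()) * M.amariMap (fun i => z (Sum.inl i)) (e a)

/-- The domain of the cone over Amari's map. -/
def coneDomain (M : StatModel ι Ω) : Set (ι ⊕ Unit → ℝ) :=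
  {z | (fun i => z (Sum.inl i)) ∈ M.domain ∧ z (Sum.inr ()) ∈ Set.Ioi (0 : ℝ)}

theorem isOpen_coneDomain (hM : M.IsSaturated G) : IsOpen (coneDomain M) :=
  (hM.isOpen.preimage (continuous_pi fun i => continuous_apply (Sum.inl i))).inter
    (isOpen_Ioi.preimage (continuous_apply (Sum.inr ())))

theorem sum_cone_sq (hM : M.IsSaturated G) (e : ι ⊕ Unit ≃ Ω) {z : ι ⊕ Unit → ℝ}
    (hz : z ∈ coneDomain M) : ∑ a, cone M e z a ^ 2 = 4 * z (Sum.inr ()) ^ 2 := by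
  simp only [cone, mul_pow, hM.amariMap_sq hz.1]
  rw [e.sum_comp fun x => z (Sum.inr ()) ^ 2 * (4 * M.prob (fun i => z (Sum.inl i)) x),
    ← Finset.mul_sum, ← Finset.mul_sum, hM.sum_eq_one _ hz.1]
  ring

theorem injOn_cone (hM : M.IsSaturated G) (e : ι ⊕ Unit ≃ Ω) :
    Set.InjOn (cone M e) (coneDomain M) := by
  intro z hz w hw h
  have h1 := hM.sum_cone_sq e hz
  rw [h, hM.sum_cone_sq e hw] at h1
  have hz0 : 0 < z (Sum.inr ()) := hz.2
  have hw0 : 0 < w (Sum.inr ()) := hw.2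
  have ht : z (Sum.inr ()) = w (Sum.inr ()) := by nlinarith
  have hF : M.amariMap (fun i => z (Sum.inl i)) = M.amariMap (fun i => w (Sum.inl i)) := by
    ext x
    have := congrFun h (e.symm x)
    simp only [cone, ht, Equiv.apply_symm_apply] at this
    exact mul_left_cancel₀ hw0.ne' this
  have hθ := hM.isIsometryOnto.bijOn.injOn hz.1 hw.1 hF
  funext a
  rcases a with i | u
  · exact congrFun hθ i
  · exact ht

/-- Polar decomposition: each point of the open orthant is a unique positive multiple of a point of
the spherical orthant, and the latter is covered by Amari's map. -/
theorem image_cone (hM : M.IsSaturated G) (e : ι ⊕ Unit ≃ Ω) :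
    cone M e '' coneDomain M = Set.univ.pi fun _ => Set.Ioi (0 : ℝ) := by
  ext y
  constructor
  · rintro ⟨z, hz, rfl⟩ a -
    exact mul_pos hz.2 (hM.amariMap_pos hz.1 (e a))
  · intro hy
    have hy0 : ∀ a, 0 < y a := fun a => hy a trivial
    set s := ∑ a, y a ^ 2 with hs
    have hs0 : 0 < s := Finset.sum_pos (fun a _ => pow_pos (hy0 a) 2) ⟨Sum.inr (), by simp⟩
    -- Forced by `sum_cone_sq`: the sphere has radius `2`, so `s = 4 t²`.
    set t := Real.sqrt s / 2 with ht
    have ht0 : 0 < t := by positivity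
    have ht2 : 4 * t ^ 2 = s := by rw [ht, div_pow, Real.sq_sqrt hs0.le]; ring
    have hmem : (WithLp.toLp 2 fun x => y (e.symm x) / t : EuclideanSpace ℝ Ω)
        ∈ positiveSphereOrthant Ω 2 := by
      refine ⟨?_, fun x => div_pos (hy0 _) ht0⟩
      rw [mem_sphere_zero_iff_norm, ← sq_eq_sq₀ (norm_nonneg _) two_pos.le,
        EuclideanSpace.real_norm_sq_eq]
      simp only [div_pow]
      rw [← Finset.sum_div, e.symm.sum_comp fun a => y a ^ 2, ← hs, ← ht2]
      field_simp
      norm_num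
    obtain ⟨θ, hθ, hF⟩ := hM.isIsometryOnto.bijOn.surjOn hmem
    refine ⟨Sum.elim θ fun _ => t, ⟨hθ, ht0⟩, ?_⟩
    funext a
    simp only [cone, Sum.elim_inr, Sum.elim_inl]
    rw [show (fun i => θ i) = θ from rfl, hF]
    simp only [Equiv.symm_apply_apply]
    field_simp

/-- The derivative of the cone over Amari's map. -/
def coneDeriv (M : StatModel ι Ω) (e : ι ⊕ Unit ≃ Ω) (z : ι ⊕ Unit → ℝ) :
    (ι ⊕ Unit → ℝ) →L[ℝ] (ι ⊕ Unit → ℝ) :=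
  ContinuousLinearMap.pi fun a =>
    z (Sum.inr ()) • ((EuclideanSpace.proj (e a) : EuclideanSpace ℝ Ω →L[ℝ] ℝ).comp
      ((fderiv ℝ M.amariMap fun i => z (Sum.inl i)).comp
        (ContinuousLinearMap.pi fun i => ContinuousLinearMap.proj (Sum.inl i))))
    + M.amariMap (fun i => z (Sum.inl i)) (e a) • ContinuousLinearMap.proj (Sum.inr ())

theorem hasFDerivAt_cone (hM : M.IsSaturated G) (e : ι ⊕ Unit ≃ Ω) {z : ι ⊕ Unit → ℝ}
    (hz : z ∈ coneDomain M) : HasFDerivAt (cone M e) (coneDeriv M e z) z := by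
  refine hasFDerivAt_pi.2 fun a => ?_
  have hF : HasFDerivAt M.amariMap (fderiv ℝ M.amariMap fun i => z (Sum.inl i))
      ((fun (z : ι ⊕ Unit → ℝ) i => z (Sum.inl i)) z) :=
    (hM.contDiffOn_amariMap.differentiableAt_of_isOpen hM.isOpen hz.1).hasFDerivAt
  have hP : HasFDerivAt (fun z : ι ⊕ Unit → ℝ => fun i => z (Sum.inl i))
      (ContinuousLinearMap.pi fun i => ContinuousLinearMap.proj (R := ℝ) (φ := fun _ => ℝ)
        (Sum.inl i : ι ⊕ Unit)) z :=
    (ContinuousLinearMap.pi fun i => ContinuousLinearMap.proj (R := ℝ) (φ := fun _ => ℝ)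
      (Sum.inl i : ι ⊕ Unit)).hasFDerivAt
  have hr : HasFDerivAt (fun z : ι ⊕ Unit → ℝ => z (Sum.inr ()))
      (ContinuousLinearMap.proj (R := ℝ) (φ := fun _ => ℝ) (Sum.inr () : ι ⊕ Unit)) z :=
    (ContinuousLinearMap.proj (R := ℝ) (φ := fun _ => ℝ) (Sum.inr () : ι ⊕ Unit)).hasFDerivAt
  have hE := (EuclideanSpace.proj (e a) : EuclideanSpace ℝ Ω →L[ℝ] ℝ).hasFDerivAt.comp z
    (hF.comp z hP)
  exact hr.mul hE

theorem coneDeriv_single_inl (e : ι ⊕ Unit ≃ Ω) (z : ι ⊕ Unit → ℝ) (i : ι) (a : ι ⊕ Unit) :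
    coneDeriv M e z (Pi.single (Sum.inl i) 1) a
      = z (Sum.inr ()) * vecPartial i M.amariMap (fun i => z (Sum.inl i)) (e a) := by
  have h : (fun j => (Pi.single (Sum.inl i) 1 : ι ⊕ Unit → ℝ) (Sum.inl j)) = Pi.single i 1 := by
    funext j
    simp [Pi.single_apply]
  have h2 : coneDeriv M e z (Pi.single (Sum.inl i) 1) a = z (Sum.inr ()) *
      fderiv ℝ M.amariMap (fun i => z (Sum.inl i))
        (fun j => (Pi.single (Sum.inl i) 1 : ι ⊕ Unit → ℝ) (Sum.inl j)) (e a)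
      + M.amariMap (fun i => z (Sum.inl i)) (e a) *
        (Pi.single (Sum.inl i) 1 : ι ⊕ Unit → ℝ) (Sum.inr ()) := rfl
  rw [h2, h]
  simp [vecPartial]

theorem coneDeriv_single_inr (e : ι ⊕ Unit ≃ Ω) (z : ι ⊕ Unit → ℝ) (u : Unit) (a : ι ⊕ Unit) :
    coneDeriv M e z (Pi.single (Sum.inr u) 1) a
      = M.amariMap (fun i => z (Sum.inl i)) (e a) := by
  have h : (fun j => (Pi.single (Sum.inr u) 1 : ι ⊕ Unit → ℝ) (Sum.inl j)) = 0 := by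
    funext j
    simp
  have h2 : coneDeriv M e z (Pi.single (Sum.inr u) 1) a = z (Sum.inr ()) *
      fderiv ℝ M.amariMap (fun i => z (Sum.inl i))
        (fun j => (Pi.single (Sum.inr u) 1 : ι ⊕ Unit → ℝ) (Sum.inl j)) (e a)
      + M.amariMap (fun i => z (Sum.inl i)) (e a) *
        (Pi.single (Sum.inr u) 1 : ι ⊕ Unit → ℝ) (Sum.inr ()) := rfl
  rw [h2, h]
  simp

/-- The Gram matrix of the Jacobian is block diagonal, because the radial direction is orthogonal to
the tangent vectors. Its blocks are `t² g` and `4`, and the absolute determinant is the square root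
of the Gram determinant. -/
theorem abs_det_coneDeriv (hM : M.IsSaturated G)
    (hcard : Fintype.card Ω = Fintype.card ι + 1) (e : ι ⊕ Unit ≃ Ω) {z : ι ⊕ Unit → ℝ}
    (hz : z ∈ coneDomain M) : |(coneDeriv M e z).det|
      = Real.sqrt (M.fisher fun i => z (Sum.inl i)).det
        * (2 * z (Sum.inr ()) ^ Fintype.card ι) := by
  have hc := hM.isSphericalChart hcard
  set θ : ι → ℝ := fun i => z (Sum.inl i) with hθ
  set t := z (Sum.inr ()) with ht
  have hz1 : θ ∈ M.domain := hz.1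
  have ht0 : 0 < t := hz.2
  let A := LinearMap.toMatrix' (coneDeriv M e z : (ι ⊕ Unit → ℝ) →ₗ[ℝ] ι ⊕ Unit → ℝ)
  have hA1 : ∀ a i, A a (Sum.inl i) = t * vecPartial i M.amariMap θ (e a) := fun a i =>
    (LinearMap.toMatrix'_apply _ _ _).trans (coneDeriv_single_inl e z i a)
  have hA2 : ∀ a u, A a (Sum.inr u) = M.amariMap θ (e a) := fun a u =>
    (LinearMap.toMatrix'_apply _ _ _).trans (coneDeriv_single_inr e z u a)
  have hinner : ∀ v w : EuclideanSpace ℝ Ω, ∑ a, v (e a) * w (e a) = inner ℝ v w := by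
    intro v w
    rw [e.sum_comp fun x => v x * w x, PiLp.inner_apply]
    exact Finset.sum_congr rfl fun x _ => mul_comm _ _
  have hAA : A.transpose * A = Matrix.fromBlocks (t ^ 2 • M.fisher θ) 0 0 ((4 : ℝ) • 1) := by
    ext a b
    rw [Matrix.mul_apply]
    simp only [Matrix.transpose_apply]
    rcases a with i | u <;> rcases b with j | v
    · simp only [hA1, Matrix.fromBlocks_apply₁₁, Matrix.smul_apply, smul_eq_mul,
        hM.fisher_apply hz1, ← hinner, Finset.mul_sum]
      exact Finset.sum_congr rfl fun x _ => by ring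
    · simp only [hA1, hA2, Matrix.fromBlocks_apply₁₂, Matrix.zero_apply, mul_assoc,
        ← Finset.mul_sum, hinner, hc.inner_partial_self hz1, mul_zero]
    · simp only [hA1, hA2, Matrix.fromBlocks_apply₂₁, Matrix.zero_apply]
      have := hc.inner_partial_self hz1 j
      rw [← hinner] at this
      rw [← mul_zero t, ← this, Finset.mul_sum]
      exact Finset.sum_congr rfl fun x _ => by ring
    · simp only [hA2, hinner, hM.inner_amariMap_self hz1, Matrix.fromBlocks_apply₂₂,
        Matrix.smul_apply, Matrix.one_apply_eq, smul_eq_mul, mul_one]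
  have hdet : (coneDeriv M e z).det = A.det := (LinearMap.det_toMatrix' _).symm
  have hsq : A.det ^ 2 = (M.fisher θ).det * (2 * t ^ Fintype.card ι) ^ 2 := by
    have := congrArg Matrix.det hAA
    rw [Matrix.det_mul, Matrix.det_transpose, Matrix.det_fromBlocks_zero₂₁, Matrix.det_smul,
      Matrix.det_smul] at this
    simp only [Fintype.card_unit, pow_one, Matrix.det_one, mul_one] at this
    rw [sq, this]; ring
  rw [hdet, ← Real.sqrt_sq_eq_abs, hsq, Real.sqrt_mul (hM.posDef_fisher hz1).det_pos.le,
    Real.sqrt_sq (by positivity)]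

/-- The Fisher volume of a saturated model on `N` outcomes is the volume of the positive orthant
of the `(N - 1)`-dimensional sphere of radius `2`. -/
theorem fisherVolume_eq (hM : M.IsSaturated G)
    (hcard : Fintype.card Ω = Fintype.card ι + 1) :
    M.fisherVolume = ENNReal.ofReal
      (Real.sqrt Real.pi ^ Fintype.card Ω / Real.Gamma (Fintype.card Ω / 2)) := by
  let e : ι ⊕ Unit ≃ Ω := Fintype.equivOfCardEq (by simp [hcard])
  have hmeas : MeasurableSet (coneDomain M) := hM.isOpen_coneDomain.measurableSet
  have h1 := lintegral_image_eq_lintegral_abs_det_fderiv_mul volume hmeas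
    (fun z hz => (hM.hasFDerivAt_cone e hz).hasFDerivWithinAt) (hM.injOn_cone e)
    (fun y => ENNReal.ofReal (Real.exp (-∑ a, y a ^ 2)))
  rw [hM.image_cone e, lintegral_orthant_exp_neg_sum_sq] at h1
  have h2 : ∫⁻ z in coneDomain M, ENNReal.ofReal |(coneDeriv M e z).det|
        * ENNReal.ofReal (Real.exp (-∑ a, cone M e z a ^ 2))
      = ∫⁻ z in coneDomain M,
        ENNReal.ofReal (Real.sqrt (M.fisher fun i => z (Sum.inl i)).det) * ENNReal.ofReal
          (2 * z (Sum.inr ()) ^ Fintype.card ι * Real.exp (-(4 * z (Sum.inr ()) ^ 2))) := by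
    refine setLIntegral_congr_fun hmeas fun z hz => ?_
    have ht : 0 < z (Sum.inr ()) := hz.2
    simp only [hM.abs_det_coneDeriv hcard e hz, hM.sum_cone_sq e hz]
    rw [ENNReal.ofReal_mul (Real.sqrt_nonneg _), mul_assoc, ← ENNReal.ofReal_mul (by positivity)]
  have hg : ContinuousOn (fun θ => ENNReal.ofReal (Real.sqrt (M.fisher θ).det)) M.domain := by
    refine ENNReal.continuous_ofReal.comp_continuousOn
      (Real.continuous_sqrt.comp_continuousOn ?_)
    simp only [Matrix.det_apply']
    exact continuousOn_finsetSum _ fun σ _ => continuousOn_const.mul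
      (continuousOn_finsetProd _ fun k _ => ((hM.isRiemannianMetricOn hcard).1 _ _).continuousOn)
  rw [h2, coneDomain, setLIntegral_sum_unit_mul (hg.aemeasurable hM.isOpen.measurableSet)
    (h := fun t => ENNReal.ofReal (2 * t ^ Fintype.card ι * Real.exp (-(4 * t ^ 2))))
    (by fun_prop), lintegral_radial_gaussian, ← hcard] at h1
  have hc2 : Fintype.card (ι ⊕ Unit) = Fintype.card Ω := Fintype.card_congr e
  have hN : (0 : ℝ) < Fintype.card Ω := by rw [hcard]; positivity
  have hG : 0 < Real.Gamma ((Fintype.card Ω : ℝ) / 2) := Real.Gamma_pos_of_pos (by positivity)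
  have hq : 0 < Real.Gamma ((Fintype.card Ω : ℝ) / 2) / 2 ^ Fintype.card Ω := by positivity
  rw [hc2] at h1
  change _ = M.fisherVolume * _ at h1
  -- The radial integral is positive and finite, so it can be divided out; the factors `2 ^ card Ω`
  -- cancel.
  rw [(ENNReal.eq_div_iff (ENNReal.ofReal_pos.2 hq).ne' ENNReal.ofReal_ne_top).2
    ((mul_comm _ _).trans h1.symm), ← ENNReal.ofReal_div_of_pos hq]
  congr 1
  rw [div_pow]
  field_simp

end StatModel.IsSaturated

/-! ### The multinomial model is saturated. -/

theorem isSaturated_multinomialModel {Ω : Type*} [Fintype Ω] [DecidableEq Ω] (o : Ω) :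
    (multinomialModel o).IsSaturated fun q y => q y where
  isOpen := by
    refine IsOpen.inter ?_ (isOpen_lt (continuous_finsetSum _ fun x _ => continuous_apply x)
      continuous_const)
    change IsOpen {p : {x // x ≠ o} → ℝ | ∀ x, 0 < p x}
    simp only [Set.ofPred_forall]
    exact isOpen_iInter_of_finite fun x => isOpen_lt continuous_const (continuous_apply x)
  smooth x := by
    by_cases h : x = o
    · simp only [multinomialModel, h, dite_true]
      fun_prop
    · simp only [multinomialModel, h, dite_false]
      fun_prop
  pos θ hθ x := by
    by_cases h : x = o
    · simp only [multinomialModel, h, dite_true]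
      exact sub_pos.2 hθ.2
    · simp only [multinomialModel, h, dite_false]
      exact hθ.1 _
  sum_eq_one θ _ := by
    rw [Fintype.sum_eq_add_sum_subtype_ne _ o]
    have : ∀ y : {x // x ≠ o}, (multinomialModel o).prob θ y = θ y := fun y => by
      simp [multinomialModel, y.2]
    simp [this]
    simp [multinomialModel]
  smooth_inverse := by fun_prop
  left_inv θ _ := by
    funext y
    simp [multinomialModel, y.2]
  mem_domain q hq hsum := by
    refine ⟨fun x => hq x, ?_⟩
    rw [Fintype.sum_eq_add_sum_subtype_ne _ o] at hsum
    have := hq o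
    linarith
  right_inv q _ hsum := by
    funext x
    rw [Fintype.sum_eq_add_sum_subtype_ne _ o] at hsum
    by_cases h : x = o
    · simp only [multinomialModel, h, dite_true]
      linarith
    · simp [multinomialModel, h]

/-! ### The complete bitnet is saturated: marginals and the chain rule. -/

section CompleteBitnet

variable {n : ℕ}

theorem card_param_completeDAG (n : ℕ) : Fintype.card (completeDAG n).Param = 2 ^ n - 1 := by
  have h : ∀ k : Fin n, Fintype.card ((completeDAG n).Parents k) = k := by
    intro k
    rw [Fintype.card_subtype]
    have : (Finset.univ.filter fun j : Fin n => (completeDAG n).Adj j k) = Finset.Iio k := by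
      ext j
      rw [Finset.mem_filter_univ, Finset.mem_Iio]
      rfl
    rw [this, Fin.card_Iio]
  have h2 : ∀ k : Fin n, Fintype.card ((completeDAG n).Parents k → Bool) = 2 ^ (k : ℕ) := by
    intro k
    rw [Fintype.card_fun, Fintype.card_bool, h]
  rw [Fintype.card_sigma, Finset.sum_congr rfl fun k _ => h2 k]
  rw [Fin.sum_univ_eq_sum_range fun k => 2 ^ k, Nat.geomSum_eq le_rfl]
  simp

/-- The total mass that `q` gives to the configurations that agree with `y` on the first `m`
nodes. -/
def marginal (q : (Fin n → Bool) → ℝ) (m : ℕ) (y : Fin n → Bool) : ℝ :=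
  ∑ x with ∀ j : Fin n, (j : ℕ) < m → x j = y j, q x

theorem marginal_congr (q : (Fin n → Bool) → ℝ) {m : ℕ} {y z : Fin n → Bool}
    (h : ∀ j : Fin n, (j : ℕ) < m → y j = z j) : marginal q m y = marginal q m z := by
  unfold marginal
  congr 1
  ext x
  simp only [Finset.mem_filter, Finset.mem_univ, true_and]
  exact forall₂_congr fun j hj => by rw [h j hj]

theorem marginal_zero (q : (Fin n → Bool) → ℝ) (y : Fin n → Bool) :
    marginal q 0 y = ∑ x, q x := by
  simp [marginal]

theorem marginal_self (q : (Fin n → Bool) → ℝ) (y : Fin n → Bool) : marginal q n y = q y := by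
  simp [marginal, ← funext_iff, Finset.filter_eq']

theorem marginal_pos {q : (Fin n → Bool) → ℝ} (hq : ∀ x, 0 < q x) (m : ℕ) (y : Fin n → Bool) :
    0 < marginal q m y :=
  Finset.sum_pos (fun x _ => hq x) ⟨y, by simp⟩

theorem marginal_eq_add (q : (Fin n → Bool) → ℝ) (k : Fin n) (y : Fin n → Bool) :
    marginal q k y = marginal q (k + 1) (Function.update y k true)
      + marginal q (k + 1) (Function.update y k false) := by
  have h : ∀ b, (Finset.univ.filter fun x : Fin n → Bool =>
      ∀ j : Fin n, (j : ℕ) < k + 1 → x j = Function.update y k b j)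
      = (Finset.univ.filter fun x : Fin n → Bool =>
        ∀ j : Fin n, (j : ℕ) < k → x j = y j).filter fun x => x k = b := by
    intro b
    ext x
    simp only [Finset.mem_filter, Finset.mem_univ, true_and]
    constructor
    · refine fun hx => ⟨fun j hj => ?_, ?_⟩
      · have := hx j (by omega)
        rwa [Function.update_of_ne (by rintro rfl; omega)] at this
      · simpa using hx k (by omega)
    · rintro ⟨hx, hb⟩ j hj
      by_cases hjk : j = k
      · subst hjk; simpa using hb
      · rw [Function.update_of_ne hjk]
        exact hx j (by have := Fin.val_ne_of_ne hjk; omega)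
  rw [marginal, marginal, marginal, h, h,
    ← Finset.sum_filter_add_sum_filter_not _ fun x : Fin n → Bool => x k = true]
  simp only [Bool.not_eq_true]

theorem contDiff_marginal (m : ℕ) (y : Fin n → Bool) :
    ContDiff ℝ ∞ fun q : (Fin n → Bool) → ℝ => marginal q m y := by
  unfold marginal
  fun_prop

/-- The conditional probability of the state of node `k` in the configuration `x`, given the
states of its parents. -/
def conditionalFactor (θ : (completeDAG n).Param → ℝ) (x : Fin n → Bool) (k : Fin n) : ℝ :=
  if x k then θ ⟨k, fun j => x j⟩ else 1 - θ ⟨k, fun j => x j⟩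

theorem completeBitnet_prob (θ : (completeDAG n).Param → ℝ) (x : Fin n → Bool) :
    (completeBitnet n).prob θ x = ∏ k, conditionalFactor θ x k := rfl

theorem conditionalFactor_pos {θ : (completeDAG n).Param → ℝ}
    (hθ : θ ∈ (completeBitnet n).domain) (x : Fin n → Bool) (k : Fin n) :
    0 < conditionalFactor θ x k := by
  unfold conditionalFactor
  split_ifs
  · exact (hθ _).1
  · exact sub_pos.2 (hθ _).2

/-- The parents of `k` all precede `k`, so its factor depends only on an initial segment of the
configuration. -/
theorem conditionalFactor_congr (θ : (completeDAG n).Param → ℝ) {x y : Fin n → Bool} {k : Fin n}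
    (h : ∀ j ≤ k, x j = y j) : conditionalFactor θ x k = conditionalFactor θ y k := by
  have hs : (fun j : (completeDAG n).Parents k => x j)
      = fun j : (completeDAG n).Parents k => y j :=
    funext fun j => h j (le_of_lt j.2)
  rw [conditionalFactor, conditionalFactor, h k le_rfl, hs]

theorem conditionalFactor_update_add (θ : (completeDAG n).Param → ℝ) (x : Fin n → Bool)
    (k : Fin n) : conditionalFactor θ (Function.update x k true) k
      + conditionalFactor θ (Function.update x k false) k = 1 := by
  have hs : ∀ b, (fun j : (completeDAG n).Parents k => Function.update x k b j)
      = fun j : (completeDAG n).Parents k => x j :=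
    fun b => funext fun j => Function.update_of_ne (ne_of_lt j.2) _ _
  simp [conditionalFactor, hs]

theorem prod_filter_lt_succ (f : Fin n → ℝ) (k : Fin n) :
    ∏ j ∈ Finset.univ.filter (fun j : Fin n => (j : ℕ) < k + 1), f j 
      = f k * ∏ j ∈ Finset.univ.filter (fun j : Fin n => (j : ℕ) < k), f j := by
  have : (Finset.univ.filter fun j : Fin n => (j : ℕ) < k + 1)
      = insert k (Finset.univ.filter fun j : Fin n => (j : ℕ) < k) := by
    ext j
    simp only [Finset.mem_filter, Finset.mem_univ, true_and, Finset.mem_insert, Fin.ext_iff]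
    omega
  rw [this, Finset.prod_insert (by simp)]

/-- The marginals of a Bayesian network are the products of the first conditional
probabilities. -/
theorem marginal_completeBitnet (θ : (completeDAG n).Param → ℝ) {m : ℕ} (hm : m ≤ n)
    (y : Fin n → Bool) : marginal ((completeBitnet n).prob θ) m y
      = ∏ k ∈ Finset.univ.filter (fun k : Fin n => (k : ℕ) < m), conditionalFactor θ y k := by
  -- Downward from `m = n`, where the marginal is the full product: summing out node `m` removes its
  -- factor, whose two values add to `1`.
  induction hm using Nat.decreasingInduction generalizing y with
  | self =>
    rw [marginal_self, completeBitnet_prob]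
    simp
  | of_succ m hm ih =>
    have h := marginal_eq_add ((completeBitnet n).prob θ) ⟨m, hm⟩ y
    have hp : ∀ b, ∏ k ∈ Finset.univ.filter (fun k : Fin n => (k : ℕ) < m),
        conditionalFactor θ (Function.update y ⟨m, hm⟩ b) k
        = ∏ k ∈ Finset.univ.filter (fun k : Fin n => (k : ℕ) < m), conditionalFactor θ y k := by
      intro b
      refine Finset.prod_congr rfl fun k hk => conditionalFactor_congr θ fun j hj => ?_
      have hkm : (k : ℕ) < m := by simpa using hk
      refine Function.update_of_ne (fun he => ?_) _ _
      have h1 : (j : ℕ) = m := by rw [he]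
      have h2 : (j : ℕ) ≤ k := hj
      omega
    have h3 := fun b => prod_filter_lt_succ
      (conditionalFactor θ (Function.update y ⟨m, hm⟩ b)) ⟨m, hm⟩
    simp only at h h3
    rw [h, ih, ih, h3, h3, hp, hp, ← add_mul, conditionalFactor_update_add, one_mul]

/-- The configuration that extends the parent configuration `s` of `k` by `true`. -/
def extendParents (k : Fin n) (s : (completeDAG n).Parents k → Bool) (j : Fin n) : Bool :=
  if h : j < k then s ⟨j, h⟩ else true

theorem extendParents_restrict (k : Fin n) (s : (completeDAG n).Parents k → Bool) :
    (fun j : (completeDAG n).Parents k => extendParents k s j) = s := by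
  funext j
  exact dif_pos j.2

theorem extendParents_self (k : Fin n) (s : (completeDAG n).Parents k → Bool) :
    extendParents k s k = true := dif_neg (lt_irrefl k)

/-- The conditional probabilities `P(X_k = 1 | X_{pa(k)} = s)` of a distribution `q`. -/
def conditionalProbability (q : (Fin n → Bool) → ℝ) (a : (completeDAG n).Param) : ℝ :=
  marginal q (a.1 + 1) (extendParents a.1 a.2) / marginal q a.1 (extendParents a.1 a.2)

/-- For `x k = true` this is the definition, up to coordinates the marginals ignore; for `x k =
false` it is the complementary mass from `marginal_eq_add`. -/
theorem conditionalFactor_conditionalProbability {q : (Fin n → Bool) → ℝ} (hq : ∀ x, 0 < q x)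
    (x : Fin n → Bool) (k : Fin n) :
    conditionalFactor (conditionalProbability q) x k = marginal q (k + 1) x / marginal q k x := by
  set z := extendParents k fun j : (completeDAG n).Parents k => x j with hz
  have hzx : ∀ j : Fin n, (j : ℕ) < k → z j = x j := fun j hj =>
    dif_pos (show j < k from hj)
  have h1 : marginal q k z = marginal q k x := marginal_congr q hzx
  have h2 : marginal q (k + 1) z = marginal q (k + 1) (Function.update x k true) := by
    refine marginal_congr q fun j hj => ?_
    by_cases hjk : j = k
    · subst hjk
      rw [Function.update_self, hz, extendParents_self]
    · rw [Function.update_of_ne hjk]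
      exact hzx j (by have := Fin.val_ne_of_ne hjk; omega)
  have hc : conditionalProbability q ⟨k, fun j => x j⟩
      = marginal q (k + 1) (Function.update x k true) / marginal q k x := by
    rw [← h1, ← h2]; rfl
  have hpos := marginal_pos hq k x
  rw [conditionalFactor, hc]
  cases hxk : x k
  · have hu : Function.update x k false = x := by rw [← hxk, Function.update_eq_self]
    have := marginal_eq_add q k x
    rw [hu] at this
    simp only [Bool.false_eq_true, if_false]
    rw [eq_div_iff hpos.ne', sub_mul, div_mul_cancel₀ _ hpos.ne']
    linarith
  · rw [if_pos rfl, ← hxk, Function.update_eq_self]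

theorem isSaturated_completeBitnet (n : ℕ) :
    (completeBitnet n).IsSaturated conditionalProbability where
  isOpen := by
    change IsOpen {θ : (completeDAG n).Param → ℝ | ∀ a, θ a ∈ Set.Ioo (0 : ℝ) 1}
    simp only [Set.ofPred_forall]
    exact isOpen_iInter_of_finite fun a => isOpen_Ioo.preimage (continuous_apply a)
  smooth x := by
    simp only [completeBitnet_prob]
    refine contDiffOn_prod fun k _ => ?_
    unfold conditionalFactor
    split_ifs <;> fun_prop
  pos θ hθ x := by
    rw [completeBitnet_prob]
    exact Finset.prod_pos fun k _ => conditionalFactor_pos hθ x k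
  sum_eq_one θ _ := by
    have := marginal_completeBitnet θ (Nat.zero_le n) fun _ => true
    rw [marginal_zero] at this
    simpa using this
  smooth_inverse := contDiffOn_pi.2 fun a => (contDiff_marginal _ _).contDiffOn.div
    (contDiff_marginal _ _).contDiffOn fun _ hq => (marginal_pos hq _ _).ne'
  left_inv θ hθ := by
    funext ⟨k, s⟩
    -- Consecutive marginals of the model differ by one factor, which is the parameter because
    -- `extendParents` sets node `k` to `true`.
    rw [conditionalProbability, marginal_completeBitnet θ k.2,
      marginal_completeBitnet θ k.2.le, prod_filter_lt_succ, mul_div_cancel_right₀]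
    · rw [conditionalFactor, extendParents_self, if_pos rfl, extendParents_restrict]
    · exact (Finset.prod_pos fun j _ => conditionalFactor_pos hθ _ j).ne'
  mem_domain q hq _ := by
    rintro ⟨k, s⟩
    have hpos := marginal_pos hq k (extendParents k s)
    refine ⟨div_pos (marginal_pos hq _ _) hpos, (div_lt_one hpos).2 ?_⟩
    have h := marginal_eq_add q k (extendParents k s)
    have hu : Function.update (extendParents k s) k true = extendParents k s := by
      rw [← extendParents_self k s, Function.update_eq_self]
    rw [hu] at h
    have := marginal_pos hq (k + 1) (Function.update (extendParents k s) k false)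
    simp only
    linarith
  right_inv q hq hsum := by
    funext x
    rw [completeBitnet_prob]
    simp only [conditionalFactor_conditionalProbability hq]
    rw [Fin.prod_univ_eq_prod_range fun k => marginal q (k + 1) x / marginal q k x]
    -- Telescoping, from total mass `1` at `m = 0` to `q x` at `m = n`.
    have h : ∀ m, ∏ k ∈ Finset.range m, marginal q (k + 1) x / marginal q k x
        = marginal q m x / marginal q 0 x := by
      intro m
      induction m with
      | zero => simp [(marginal_pos hq 0 x).ne']
      | succ m ih =>
        rw [Finset.prod_range_succ, ih, mul_comm, div_mul_div_cancel₀ (marginal_pos hq m x).ne']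
    rw [h, marginal_self, marginal_zero, hsum, div_one]

end CompleteBitnet

/-! ### Assembly: dimension counts and closed forms. -/

theorem mainTheorem5 (n : ℕ) (hn : 1 ≤ n) (o : Fin n → Bool) :
    -- the complete bitnet is the multinomial model on `2 ^ n` outcomes, of dimension `2 ^ n - 1`
    (completeBitnet n).Equivalent (multinomialModel o) ∧
    Fintype.card (Fin n → Bool) = 2 ^ n ∧
    Fintype.card (completeDAG n).Param = 2 ^ n - 1 ∧
    -- the complete bitnet: Fisher metric, sphere isometry, volume, Ricci scalar
    IsRiemannianMetricOn (completeBitnet n).fisher (completeBitnet n).domain ∧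
    IsIsometryOnto (completeBitnet n).fisher (completeBitnet n).domain
      (completeBitnet n).amariMap (positiveSphereOrthant (Fin n → Bool) 2) ∧
    (completeBitnet n).fisherVolume =
      ENNReal.ofReal (Real.pi ^ (2 ^ (n - 1)) / (Nat.factorial (2 ^ (n - 1) - 1) : ℝ)) ∧
    (∀ θ ∈ (completeBitnet n).domain,
      ricciScalar (completeBitnet n).fisher θ = ((2 : ℝ) ^ n - 1) * ((2 : ℝ) ^ n - 2) / 4) ∧
    -- the multinomial model in its standard coordinates
    IsRiemannianMetricOn (multinomialModel o).fisher (multinomialModel o).domain ∧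
    IsIsometryOnto (multinomialModel o).fisher (multinomialModel o).domain
      (multinomialModel o).amariMap (positiveSphereOrthant (Fin n → Bool) 2) ∧
    (multinomialModel o).fisherVolume =
      ENNReal.ofReal (Real.pi ^ (2 ^ (n - 1)) / (Nat.factorial (2 ^ (n - 1) - 1) : ℝ)) ∧
    (∀ p ∈ (multinomialModel o).domain,
      ricciScalar (multinomialModel o).fisher p = ((2 : ℝ) ^ n - 1) * ((2 : ℝ) ^ n - 2) / 4) := by
  have hB := isSaturated_completeBitnet n
  have hM := isSaturated_multinomialModel o
  have hpow : 1 ≤ 2 ^ n := Nat.one_le_two_pow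
  have hΩ : Fintype.card (Fin n → Bool) = 2 ^ n := by simp
  have hP := card_param_completeDAG n
  have hS : Fintype.card {x : Fin n → Bool // x ≠ o} = 2 ^ n - 1 := by
    rw [Fintype.card_subtype_compl, hΩ, Fintype.card_subtype_eq]
  have hcB : Fintype.card (Fin n → Bool) = Fintype.card (completeDAG n).Param + 1 := by omega
  have hcM : Fintype.card (Fin n → Bool) = Fintype.card {x : Fin n → Bool // x ≠ o} + 1 := by
    omega
  have hvol : Real.sqrt Real.pi ^ Fintype.card (Fin n → Bool)
        / Real.Gamma ((Fintype.card (Fin n → Bool) : ℕ) / 2)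
      = Real.pi ^ (2 ^ (n - 1)) / (Nat.factorial (2 ^ (n - 1) - 1) : ℝ) := by
    -- With `n ≥ 1` the number of outcomes is even, so `√π` occurs to an even power and `Γ` is taken
    -- at the integer `2 ^ m`, giving `(2 ^ m - 1)!`.
    obtain ⟨m, rfl⟩ : ∃ m, n = m + 1 := ⟨n - 1, by omega⟩
    have h1 : 1 ≤ 2 ^ m := Nat.one_le_two_pow
    have h2 : (((2 ^ (m + 1) : ℕ) : ℝ)) / 2 = ((2 ^ m - 1 : ℕ) : ℝ) + 1 := by
      rw [Nat.cast_sub h1]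
      push_cast
      ring
    rw [hΩ, h2, Real.Gamma_nat_eq_factorial, pow_succ' 2 m, pow_mul, Real.sq_sqrt Real.pi_pos.le]
    simp
  have hR : ∀ d : ℕ, d = 2 ^ n - 1 →
      (d : ℝ) * (d - 1) / 4 = ((2 : ℝ) ^ n - 1) * ((2 : ℝ) ^ n - 2) / 4 := by
    rintro d rfl
    rw [Nat.cast_sub hpow]
    push_cast
    ring
  exact ⟨hB.equivalent hM, hΩ, hP, hB.isRiemannianMetricOn hcB, hB.isIsometryOnto,
    (hB.fisherVolume_eq hcB).trans (by rw [hvol]),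
    fun θ hθ => (hB.ricciScalar_fisher hcB hθ).trans (hR _ hP),
    hM.isRiemannianMetricOn hcM, hM.isIsometryOnto,
    (hM.fisherVolume_eq hcM).trans (by rw [hvol]),
    fun p hp => (hM.ricciScalar_fisher hcM hp).trans (hR _ hS)⟩

end
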